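/- Let $A=(a_{ij})_{i,j\in I}$ ($I$ finite) be a nonsingular generalized Cartan matrix: an integer matrix with $\det A\neq 0$, $a_{ii}=2$, $a_{ij}\le 0$ for $i\ne j$, and $a_{ij}=0\Rightarrow a_{ji}=0$. Let $\mathfrak g$ be the associated complex Kac–Moody algebra, with Cartan subalgebra $\mathfrak h$, simple roots $\alpha_i\in\mathfrak h^*$, simple coroots $\alpha_i^\vee\in\mathfrak h$, $\langle\alpha_j,\alpha_i^\vee\rangle=a_{ij}$, and root set $\Phi=\Phi_+\sqcup\Phi_-$ (positive and negative roots). Let $W$ be its Weyl group, generated by the simple reflections $w_{\alpha_i}\colon\lambda\mapsto\lambda-\langle\lambda,\alpha_i^\vee\rangle\alpha_i$ of $\mathfrak h^*$, let $\ell$ be the length function on $W$ with respect to these generators, and for $v\in W$ put $\Phi_v=\Phi_+\cap v^{-1}\Phi_-$. Suppose that $A$ is symmetric and $|a_{ij}|\ge 2$ for all $i,j\in I$. Then every $w\in W$ with $w\ne 1$ can be written as $w=v\,w_\beta$ with $v\in W$, $\beta$ a simple root and $\ell(v)<\ell(w)$, such that $\alpha-\beta$ is not a real root (that is, not a root in the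 $W$-orbit of a simple root) for any $\alpha\in\Phi_v$. The same holds with "real root" replaced by "root". -/

import Mathlib

namespace KacMoody

/-- A generalized Cartan matrix. -/
structure IsGCM {ι : Type*} (A : Matrix ι ι ℤ) : Prop where
  diag : ∀ i, A i i = 2
  nonpos : ∀ i j, i ≠ j → A i j ≤ 0
  zero_symm : ∀ i j, A i j = 0 → A j i = 0

/-! ### The realization of a nonsingular matrix -/

/-- The Cartan subalgebra `𝔥`, in coordinates with respect to the simple coroots. For a nonsingular
matrix the simple coroots are a basis of `𝔥`. -/
abbrev Cartan (ι : Type*) : Type _ := ι → ℂ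

/-- The simple coroot `αᵢ^∨`. -/
def simpleCoroot {ι : Type*} [DecidableEq ι] (i : ι) : Cartan ι := Pi.single i 1

/-- The simple root `αⱼ ∈ 𝔥*`, the linear form with `⟨αⱼ, αᵢ^∨⟩ = aᵢⱼ`. -/
def simpleRoot {ι : Type*} [Fintype ι] (A : Matrix ι ι ℤ) (j : ι) : Module.Dual ℂ (Cartan ι) :=
  ∑ i, (A i j : ℂ) • LinearMap.proj i

theorem simpleRoot_simpleCoroot {ι : Type*} [Fintype ι] [DecidableEq ι] (A : Matrix ι ι ℤ)
    (i j : ι) : simpleRoot A j (simpleCoroot i) = A i j := by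
  simp [simpleRoot, simpleCoroot, LinearMap.sum_apply, Pi.single_apply]

/-! ### The Weyl group -/

/-- The simple reflection `wᵢ(lam) = lam - ⟨lam, αᵢ^∨⟩ αᵢ` of `𝔥*`. -/
noncomputable def simpleReflection {ι : Type*} [Fintype ι] [DecidableEq ι] {A : Matrix ι ι ℤ}
    (hA : IsGCM A) (i : ι) : Module.Dual ℂ (Cartan ι) ≃ₗ[ℂ] Module.Dual ℂ (Cartan ι) :=
  Module.reflection (x := simpleRoot A i)
    (f := Module.Dual.eval ℂ (Cartan ι) (simpleCoroot i))
    (by rw [Module.Dual.eval_apply, simpleRoot_simpleCoroot, hA.diag]; norm_num)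

/-- The Weyl group, generated by the simple reflections. -/
noncomputable def weylGroup {ι : Type*} [Fintype ι] [DecidableEq ι] {A : Matrix ι ι ℤ}
    (hA : IsGCM A) :
    Subgroup (Module.Dual ℂ (Cartan ι) ≃ₗ[ℂ] Module.Dual ℂ (Cartan ι)) :=
  Subgroup.closure (Set.range (simpleReflection hA))

/-- The length of a Weyl group element: the least length of a word in the simple reflections that
represents it. -/
noncomputable def weylLength {ι : Type*} [Fintype ι] [DecidableEq ι] {A : Matrix ι ι ℤ}
    (hA : IsGCM A) (w : Module.Dual ℂ (Cartan ι) ≃ₗ[ℂ] Module.Dual ℂ (Cartan ι)) : ℕ :=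
  sInf {n | ∃ l : List ι, l.length = n ∧ (l.map (simpleReflection hA)).prod = w}

/-! ### The Kac-Moody algebra and its roots

For a nonsingular symmetrizable generalized Cartan matrix `A`, the Kac-Moody algebra `𝔤(A)` over `ℂ`
is the Lie algebra `Matrix.ToLieAlgebra ℂ A` with Chevalley generators `eᵢ`, `fᵢ`, `αᵢ^∨` and the
Chevalley-Serre relations. -/

/-- The image in the Kac-Moody algebra of the `i`-th simple coroot. -/
noncomputable def generatorH {ι : Type*} [DecidableEq ι] (A : Matrix ι ι ℤ) (i : ι) :
    Matrix.ToLieAlgebra ℂ A :=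
  LieSubmodule.Quotient.mk (N := CartanMatrix.Relations.toIdeal ℂ A)
    (FreeLieAlgebra.of ℂ (CartanMatrix.Generators.H i))

/-- The inclusion of `𝔥` in the Kac-Moody algebra. -/
noncomputable def cartanInclusion {ι : Type*} [Fintype ι] [DecidableEq ι] (A : Matrix ι ι ℤ) :
    Cartan ι →ₗ[ℂ] Matrix.ToLieAlgebra ℂ A :=
  Fintype.linearCombination ℂ (generatorH A)

/-- The set `Φ` of roots: the nonzero `α ∈ 𝔥*` whose root space
`{x | [h, x] = α(h) x for all h ∈ 𝔥}` is nonzero. -/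
def roots {ι : Type*} [Fintype ι] [DecidableEq ι] (A : Matrix ι ι ℤ) :
    Set (Module.Dual ℂ (Cartan ι)) :=
  {α | α ≠ 0 ∧ ∃ x : Matrix.ToLieAlgebra ℂ A,
    x ≠ 0 ∧ ∀ h : Cartan ι, ⁅cartanInclusion A h, x⁆ = α h • x}

/-- The set `Φ₊` of positive roots. -/
def posRoots {ι : Type*} [Fintype ι] [DecidableEq ι] (A : Matrix ι ι ℤ) :
    Set (Module.Dual ℂ (Cartan ι)) :=
  {α | α ∈ roots A ∧ ∃ m : ι → ℕ, α = ∑ i, m i • simpleRoot A i}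

/-- The set `Φ₋` of negative roots. -/
def negRoots {ι : Type*} [Fintype ι] [DecidableEq ι] (A : Matrix ι ι ℤ) :
    Set (Module.Dual ℂ (Cartan ι)) :=
  {α | α ∈ roots A ∧ ∃ m : ι → ℕ, α = -∑ i, m i • simpleRoot A i}

/-- The set of real roots: the roots with a simple root in their Weyl group orbit. -/
def realRoots {ι : Type*} [Fintype ι] [DecidableEq ι] {A : Matrix ι ι ℤ} (hA : IsGCM A) :
    Set (Module.Dual ℂ (Cartan ι)) :=
  {α | α ∈ roots A ∧ ∃ w ∈ weylGroup hA, ∃ i, w α = simpleRoot A i}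

/-- The set `Φ_w = Φ₊ ∩ w⁻¹Φ₋`. -/
def inversionSet {ι : Type*} [Fintype ι] [DecidableEq ι] (A : Matrix ι ι ℤ)
    (w : Module.Dual ℂ (Cartan ι) ≃ₗ[ℂ] Module.Dual ℂ (Cartan ι)) :
    Set (Module.Dual ℂ (Cartan ι)) :=
  {α | α ∈ posRoots A ∧ w α ∈ negRoots A}

/-- Every nontrivial `w ∈ W` can be written as `w = v w_β` with `β` a simple root, `ℓ(v) < ℓ(w)`,
and `α - β ∉ S` for all `α ∈ Φ_v`. This is used for `S` the set of real roots and for `S` the set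
of all roots. -/
def DescentProperty {ι : Type*} [Fintype ι] [DecidableEq ι] {A : Matrix ι ι ℤ} (hA : IsGCM A)
    (S : Set (Module.Dual ℂ (Cartan ι))) : Prop :=
  ∀ w ∈ weylGroup hA, w ≠ 1 →
    ∃ v ∈ weylGroup hA, ∃ i : ι,
      w = v * simpleReflection hA i ∧ weylLength hA v < weylLength hA w ∧
      ∀ α ∈ inversionSet A v, α - simpleRoot A i ∉ S

end KacMoody

/-!
Every element `w ≠ 1` of the Weyl group has a reduced word; let `wᵢ` be its last letter and
`w = v wᵢ`. The claim is that `α - αᵢ` is not a root for any inversion `α` of `v`, and it follows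
from two facts about the form `(αᵢ, αⱼ) = aᵢⱼ`.

* An inversion `α` of `v` is obtained from a simple root by applying simple reflections along a word
  without equal consecutive letters whose outermost letter `j` is the last letter of `v`. Since
  `aᵢⱼ ≤ -2` off the diagonal, induction along the word gives `(α, α) = 2`, `(α, αⱼ) ≥ 2` and
  `(α, αₖ) ≤ -(α, αⱼ)` for `k ≠ j` (`HasDescent`, `exists_hasDescent_of_inversion`). As `i ≠ j`,
  the vector `α - αᵢ` has norm `4 - 2 (α, αᵢ) ≥ 8`.
* A positive root has norm at most `2` (`latticeNorm_le_two`), and `α - αᵢ` is not a negative root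
  because `α` is not a multiple of `αᵢ` (`sub_single_not_mem_roots`).

Both use only three properties of the roots of the Kac-Moody algebra: they are sums of simple roots
up to sign, the only positive root proportional to `αᵢ` is `αᵢ`
(`exists_latticeVector_of_mem_roots`), and they are permuted by the Weyl group
(`latticeReflection_mem_roots`). The first two come from a spanning set of brackets of generators
(`ChevalleyGenerators.borel_sup_borel`) and the independence of weight spaces. For the third, the
Serre relations make `ad eᵢ` and `ad fᵢ` locally nilpotent, and on an `sl₂`-representation with
locally nilpotent `e` the operator `f ^ c` is injective on vectors of weight `c`
(`sl2_eq_zero_of_pow_f_eq_zero`).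
-/

set_option linter.unusedSectionVars false

namespace KacMoody

/-! ### Representations of `sl₂` on which `e` is locally nilpotent -/

section Sl2

variable {V : Type*} [AddCommGroup V] [Module ℂ V] {e f h : Module.End ℂ V}

theorem sl2_h_pow_f (hf : ∀ x, h (f x) = f (h x) - (2 : ℂ) • f x) {x : V} {μ : ℂ}
    (hx : h x = μ • x) (k : ℕ) : h ((f ^ k) x) = (μ - 2 * k) • (f ^ k) x := by
  induction k with
  | zero => simp [hx]
  | succ k ih =>
    rw [pow_succ', Module.End.mul_apply, hf, ih, map_smul, ← sub_smul]
    push_cast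
    ring_nf

theorem sl2_e_pow_f (ef : ∀ x, e (f x) = f (e x) + h x)
    (hf : ∀ x, h (f x) = f (h x) - (2 : ℂ) • f x) {x : V} {μ : ℂ}
    (hx : h x = μ • x) (k : ℕ) :
    e ((f ^ (k + 1)) x) = (f ^ (k + 1)) (e x) + ((k + 1) * (μ - k)) • (f ^ k) x := by
  induction k with
  | zero => simp [ef, hx]
  | succ k ih =>
    rw [pow_succ' f (k + 1), Module.End.mul_apply, ef, ih, sl2_h_pow_f hf hx, map_add, map_smul,
      ← Module.End.mul_apply f, ← Module.End.mul_apply f (f ^ k), ← pow_succ' f k, add_assoc,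
      ← add_smul]
    push_cast
    ring_nf

/-- If `e` is locally nilpotent, then `f ^ c` is injective on the vectors of weight `c`. The
induction on the nilpotency exponent shows that `e x = 0`, so that `x` is a primitive vector. -/
theorem sl2_eq_zero_of_pow_f_eq_zero (ef : ∀ x, e (f x) = f (e x) + h x)
    (he : ∀ x, h (e x) = e (h x) + (2 : ℂ) • e x)
    (hf : ∀ x, h (f x) = f (h x) - (2 : ℂ) • f x) (n : ℕ) :
    ∀ (c : ℕ) (x : V), h x = (c : ℂ) • x → (e ^ n) x = 0 → (f ^ c) x = 0 → x = 0 := by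
  induction n with
  | zero => intro c x _ hn _; simpa using hn
  | succ n ih =>
    intro c x hx hn hc
    have hex : e x = 0 := by
      refine ih (c + 2) (e x) ?_ (by rwa [pow_succ, Module.End.mul_apply] at hn) ?_
      · rw [he, hx, map_smul, ← add_smul]; push_cast; rfl
      · have h1 : (f ^ (c + 1)) x = 0 := by rw [pow_succ', Module.End.mul_apply, hc, map_zero]
        have h2 : (f ^ (c + 2)) x = 0 := by rw [pow_succ', Module.End.mul_apply, h1, map_zero]
        have h3 := sl2_e_pow_f ef hf hx (c + 1)
        rw [h2, h1, map_zero, smul_zero, add_zero] at h3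
        exact h3.symm
    -- For a primitive vector, `e f ^ (k + 1) x` is a nonzero multiple of `f ^ k x` if `k < c`.
    have hdesc : ∀ d ≤ c, (f ^ (c - d)) x = 0 := by
      intro d
      induction d with
      | zero => intro _; simpa using hc
      | succ d ihd =>
        intro hd
        have h3 := sl2_e_pow_f ef hf hx (c - (d + 1))
        rw [show c - (d + 1) + 1 = c - d by omega, ihd (by omega), hex, map_zero, map_zero,
          zero_add] at h3
        refine (smul_eq_zero.1 h3.symm).resolve_left (mul_ne_zero ?_ ?_)
        · exact Nat.cast_add_one_ne_zero _
        · rw [sub_ne_zero]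
          exact_mod_cast (by omega : c ≠ c - (d + 1))
    simpa using hdesc c le_rfl

end Sl2

/-! ### Lie algebras with Chevalley generators -/

section Chevalley

variable {ι : Type*} [Fintype ι] [DecidableEq ι] {L : Type*} [LieRing L] [LieAlgebra ℂ L]

/-- The elements `hᵢ`, `eᵢ`, `fᵢ` generate the Lie algebra `L` and satisfy the Chevalley-Serre
relations for the matrix `A`. -/
structure ChevalleyGenerators (A : Matrix ι ι ℤ) (h e f : ι → L) : Prop where
  lie_h_h : ∀ i j, ⁅h i, h j⁆ = 0
  lie_e_f : ∀ i j, ⁅e i, f j⁆ = if i = j then h i else 0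
  lie_h_e : ∀ i j, ⁅h i, e j⁆ = (A i j : ℂ) • e j
  lie_h_f : ∀ i j, ⁅h i, f j⁆ = -((A i j : ℂ) • f j)
  serre_e : ∀ i j, ((LieAlgebra.ad ℂ L (e i)) ^ (-A i j).toNat) ⁅e i, e j⁆ = 0
  serre_f : ∀ i j, ((LieAlgebra.ad ℂ L (f i)) ^ (-A i j).toNat) ⁅f i, f j⁆ = 0
  generate : ∀ S : LieSubalgebra ℂ L, (∀ i, h i ∈ S) → (∀ i, e i ∈ S) → (∀ i, f i ∈ S) → S = ⊤

/-- The right-normed bracket `[e_{i₁}, [e_{i₂}, …, [e_{iₙ}, e_j]…]]` for `l = [i₁, …, iₙ]`. -/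
def bracketWord (e : ι → L) (j : ι) (l : List ι) : L := l.foldr (fun i x => ⁅e i, x⁆) (e j)

/-- The number of times each letter occurs in the word `j :: l`. -/
def wordContent (j : ι) (l : List ι) : ι → ℤ :=
  l.foldr (fun i c => Pi.single i 1 + c) (Pi.single j 1)

/-- The values on the simple coroots of the element of the root lattice with coordinates `c`. -/
def latticeWeight (A : Matrix ι ι ℤ) (c : ι → ℤ) : ι → ℂ := fun i => ((A.mulVec c i : ℤ) : ℂ)

theorem latticeWeight_add (A : Matrix ι ι ℤ) (c d : ι → ℤ) :
    latticeWeight A (c + d) = latticeWeight A c + latticeWeight A d := by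
  funext i; simp [latticeWeight, Matrix.mulVec_add]

theorem latticeWeight_single (A : Matrix ι ι ℤ) (i j : ι) :
    latticeWeight A (Pi.single j 1) i = (A i j : ℂ) := by
  simp [latticeWeight]

/-- The span of the `hᵢ` and of all right-normed brackets of the `eᵢ`. -/
def borel (h e : ι → L) : Submodule ℂ L :=
  Submodule.span ℂ (Set.range h ∪ Set.range (fun p : ι × List ι => bracketWord e p.1 p.2))

theorem mem_borel_h (h e : ι → L) (i : ι) : h i ∈ borel h e :=
  Submodule.subset_span (Or.inl ⟨i, rfl⟩)

theorem mem_borel_word (h e : ι → L) (j : ι) (l : List ι) : bracketWord e j l ∈ borel h e :=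
  Submodule.subset_span (Or.inr ⟨(j, l), rfl⟩)

theorem lie_mem_of_mem_borel {h e : ι → L} {T : Submodule ℂ L} {y : L}
    (hh : ∀ i, ⁅y, h i⁆ ∈ T) (he : ∀ j l, ⁅y, bracketWord e j l⁆ ∈ T) {x : L}
    (hx : x ∈ borel h e) : ⁅y, x⁆ ∈ T := by
  have : borel h e ≤ T.comap (LieAlgebra.ad ℂ L y) := by
    refine Submodule.span_le.2 ?_
    rintro _ (⟨i, rfl⟩ | ⟨p, rfl⟩)
    · exact hh i
    · exact he p.1 p.2
  exact this hx

/-- The vectors of weight `χ` for the commuting operators `ad hᵢ`. -/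
def weightSpace (h : ι → L) (χ : ι → ℂ) : Submodule ℂ L :=
  ⨅ i, (LieAlgebra.ad ℂ L (h i)).eigenspace (χ i)

theorem mem_weightSpace {h : ι → L} {χ : ι → ℂ} {x : L} :
    x ∈ weightSpace h χ ↔ ∀ i, ⁅h i, x⁆ = χ i • x := by
  simp [weightSpace, Submodule.mem_iInf]

namespace ChevalleyGenerators

variable {A : Matrix ι ι ℤ} {h e f : ι → L}

/-- The Chevalley involution exchanges the `eᵢ` with the `fᵢ` and negates the `hᵢ`. -/
theorem symm (C : ChevalleyGenerators A h e f) : ChevalleyGenerators A (-h) f e where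
  lie_h_h i j := by simp [C.lie_h_h]
  lie_e_f i j := by
    rw [← lie_skew, C.lie_e_f]
    by_cases hij : i = j
    · simp [hij]
    · simp [hij, Ne.symm hij]
  lie_h_e i j := by simp [C.lie_h_f]
  lie_h_f i j := by simp [C.lie_h_e]
  serre_e := C.serre_f
  serre_f := C.serre_e
  generate S hh he hf := C.generate S (fun i => by simpa using hh i) hf he

theorem bracketWord_mem_weightSpace (C : ChevalleyGenerators A h e f) (j : ι) (l : List ι) :
    bracketWord e j l ∈ weightSpace h (latticeWeight A (wordContent j l)) := by
  rw [mem_weightSpace]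
  intro k
  induction l with
  | nil => simpa [bracketWord, wordContent, latticeWeight_single] using C.lie_h_e k j
  | cons i l ih =>
    change ⁅h k, ⁅e i, bracketWord e j l⁆⁆ =
      latticeWeight A (Pi.single i 1 + wordContent j l) k • ⁅e i, bracketWord e j l⁆
    rw [leibniz_lie, ih, C.lie_h_e, smul_lie, lie_smul, latticeWeight_add, Pi.add_apply,
      latticeWeight_single, add_smul]

theorem lie_h_word_mem (C : ChevalleyGenerators A h e f) (k j : ι) (l : List ι) :
    ⁅h k, bracketWord e j l⁆ ∈ borel h e := by
  rw [mem_weightSpace.1 (C.bracketWord_mem_weightSpace j l) k]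
  exact Submodule.smul_mem _ _ (mem_borel_word _ _ _ _)

theorem lie_h_mem_borel (C : ChevalleyGenerators A h e f) (k : ι) {x : L} (hx : x ∈ borel h e) :
    ⁅h k, x⁆ ∈ borel h e :=
  lie_mem_of_mem_borel (fun i => by simp [C.lie_h_h]) (C.lie_h_word_mem k) hx

theorem lie_e_mem_borel (C : ChevalleyGenerators A h e f) (k : ι) {x : L} (hx : x ∈ borel h e) :
    ⁅e k, x⁆ ∈ borel h e := by
  refine lie_mem_of_mem_borel (fun i => ?_) (fun j l => mem_borel_word h e j (k :: l)) hx
  rw [← lie_skew, C.lie_h_e]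
  exact Submodule.neg_mem _ (Submodule.smul_mem _ _ (mem_borel_word h e k []))

theorem lie_f_word_mem (C : ChevalleyGenerators A h e f) (k j : ι) (l : List ι) :
    ⁅f k, bracketWord e j l⁆ ∈ borel h e := by
  have hfe : ∀ i, ⁅f k, e i⁆ = if k = i then -h k else 0 := fun i => by
    simpa using C.symm.lie_e_f k i
  induction l with
  | nil =>
    change ⁅f k, e j⁆ ∈ _
    rw [hfe]
    split_ifs
    · exact Submodule.neg_mem _ (mem_borel_h _ _ _)
    · exact Submodule.zero_mem _
  | cons i l ih =>
    change ⁅f k, ⁅e i, bracketWord e j l⁆⁆ ∈ _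
    rw [leibniz_lie, hfe]
    refine Submodule.add_mem _ ?_ (C.lie_e_mem_borel i ih)
    split_ifs
    · rw [neg_lie]
      exact Submodule.neg_mem _ (C.lie_h_word_mem k j l)
    · rw [zero_lie]
      exact Submodule.zero_mem _

theorem lie_e_mem_sup (C : ChevalleyGenerators A h e f) (k : ι) {x : L}
    (hx : x ∈ borel h e ⊔ borel (-h) f) : ⁅e k, x⁆ ∈ borel h e ⊔ borel (-h) f := by
  obtain ⟨y, hy, z, hz, rfl⟩ := Submodule.mem_sup.1 hx
  rw [lie_add]
  refine Submodule.add_mem _ (Submodule.mem_sup_left (C.lie_e_mem_borel k hy)) ?_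
  refine lie_mem_of_mem_borel (fun i => Submodule.mem_sup_left ?_)
    (fun j l => Submodule.mem_sup_right (C.symm.lie_f_word_mem k j l)) hz
  rw [Pi.neg_apply, lie_neg]
  exact Submodule.neg_mem _ (C.lie_e_mem_borel k (mem_borel_h _ _ _))

/-- The triangular decomposition, without directness: `L` is spanned by the `hᵢ`, the brackets of
the `eᵢ` and the brackets of the `fᵢ`. -/
theorem borel_sup_borel (C : ChevalleyGenerators A h e f) : borel h e ⊔ borel (-h) f = ⊤ := by
  set T := borel h e ⊔ borel (-h) f with hT
  let S : LieSubalgebra ℂ L :=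
    { carrier := {y | ∀ x ∈ T, ⁅y, x⁆ ∈ T}
      add_mem' := fun {a b} ha hb x hx => by
        rw [add_lie]; exact T.add_mem (ha x hx) (hb x hx)
      zero_mem' := fun x _ => by rw [zero_lie]; exact T.zero_mem
      smul_mem' := fun t a ha x hx => by rw [smul_lie]; exact T.smul_mem t (ha x hx)
      lie_mem' := fun {a b} ha hb x hx => by
        rw [lie_lie]; exact T.sub_mem (ha _ (hb x hx)) (hb _ (ha x hx)) }
  have hS : S = ⊤ := by
    refine C.generate S (fun k x hx => ?_) (fun k x hx => C.lie_e_mem_sup k hx) (fun k x hx => ?_)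
    · obtain ⟨y, hy, z, hz, rfl⟩ := Submodule.mem_sup.1 hx
      rw [lie_add]
      refine T.add_mem (Submodule.mem_sup_left (C.lie_h_mem_borel k hy))
        (Submodule.mem_sup_right ?_)
      have := C.symm.lie_h_mem_borel k hz
      rwa [Pi.neg_apply, neg_lie, Submodule.neg_mem_iff] at this
    · have := C.symm.lie_e_mem_sup k (x := x)
      rw [neg_neg, sup_comm, ← hT] at this
      exact this hx
  let T' : LieSubalgebra ℂ L :=
    { T with
      lie_mem' := fun {a b} _ hb => (hS ▸ LieSubalgebra.mem_top a : a ∈ S) b hb }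
  have hT' : T' = ⊤ :=
    C.generate T' (fun k => Submodule.mem_sup_left (mem_borel_h h e k))
      (fun k => Submodule.mem_sup_left (mem_borel_word h e k []))
      (fun k => Submodule.mem_sup_right (mem_borel_word (-h) f k []))
  refine eq_top_iff.2 fun x _ => ?_
  exact (hT' ▸ LieSubalgebra.mem_top x : x ∈ T')

theorem iSupIndep_weightSpace (C : ChevalleyGenerators A h e f) : iSupIndep (weightSpace h) := by
  refine (Module.End.independent_iInf_maxGenEigenspace_of_forall_mapsTo
    (fun i => LieAlgebra.ad ℂ L (h i)) fun i j φ => ?_).mono fun χ => ?_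
  · refine Module.End.mapsTo_maxGenEigenspace_of_comm ?_ φ
    refine LinearMap.ext fun x => ?_
    simp only [Module.End.mul_apply, LieAlgebra.ad_apply]
    rw [leibniz_lie, C.lie_h_h, zero_lie, zero_add]
  · exact iInf_mono fun i => Module.End.eigenspace_le_maxGenEigenspace

/-- A nonzero weight is, up to sign, the weight of a nonzero bracket of generators. -/
theorem exists_word_of_mem_weightSpace (C : ChevalleyGenerators A h e f) {χ : ι → ℂ} {x : L}
    (hx : x ∈ weightSpace h χ) (hx0 : x ≠ 0) (hχ : χ ≠ 0) :
    ∃ j l, (χ = latticeWeight A (wordContent j l) ∧ bracketWord e j l ≠ 0) ∨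
      (χ = -latticeWeight A (wordContent j l) ∧ bracketWord f j l ≠ 0) := by
  by_contra! hcon
  refine hx0 ?_
  have hind := C.iSupIndep_weightSpace χ
  have hle : ∀ (δ : ι → ℂ) (y : L), y ∈ weightSpace h δ → (χ = δ → y = 0) →
      y ∈ ⨆ (δ) (_ : δ ≠ χ), weightSpace h δ := by
    intro δ y hy hδ
    by_cases hd : χ = δ
    · rw [hδ hd]; exact Submodule.zero_mem _
    · exact Submodule.mem_iSup_of_mem δ (Submodule.mem_iSup_of_mem (Ne.symm hd) hy)
  have hh : ∀ i, h i ∈ ⨆ (δ) (_ : δ ≠ χ), weightSpace h δ := fun i =>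
    hle 0 _ (mem_weightSpace.2 fun k => by simp [C.lie_h_h]) fun hc => absurd hc hχ
  have htop : (⊤ : Submodule ℂ L) ≤ ⨆ (δ) (_ : δ ≠ χ), weightSpace h δ := by
    rw [← C.borel_sup_borel]
    refine sup_le (Submodule.span_le.2 ?_) (Submodule.span_le.2 ?_)
    · rintro _ (⟨i, rfl⟩ | ⟨⟨j, l⟩, rfl⟩)
      · exact hh i
      · exact hle _ _ (C.bracketWord_mem_weightSpace j l) (hcon j l).1
    · rintro _ (⟨i, rfl⟩ | ⟨⟨j, l⟩, rfl⟩)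
      · exact Submodule.neg_mem _ (hh i)
      · refine hle (-latticeWeight A (wordContent j l)) _ ?_ (hcon j l).2
        have := mem_weightSpace.1 (C.symm.bracketWord_mem_weightSpace j l)
        refine mem_weightSpace.2 fun k => ?_
        have hk := this k
        rw [Pi.neg_apply, neg_lie, neg_eq_iff_eq_neg] at hk
        rw [hk, Pi.neg_apply, neg_smul]
  exact (Submodule.disjoint_def.1 hind) x hx (htop Submodule.mem_top)

/-- The generators `eᵢ` act locally nilpotently, by the Serre relations. -/
theorem exists_ad_pow_eq_zero (C : ChevalleyGenerators A h e f) (i : ι) (x : L) :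
    ∃ n : ℕ, ((LieAlgebra.ad ℂ L (e i)) ^ n) x = 0 := by
  have hhe : ∀ j, ⁅e i, h j⁆ = -((A j i : ℂ) • e i) := fun j => by rw [← lie_skew, C.lie_h_e]
  have : LieSubalgebra.engel ℂ (e i) = ⊤ := by
    refine C.generate _ (fun j => ?_) (fun j => ?_) (fun j => ?_)
    · exact (LieSubalgebra.mem_engel_iff ℂ _ _).2 ⟨2, by simp [pow_two, hhe]⟩
    · refine (LieSubalgebra.mem_engel_iff ℂ _ _).2 ⟨(-A i j).toNat + 1, ?_⟩
      rw [pow_succ, Module.End.mul_apply]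
      exact C.serre_e i j
    · refine (LieSubalgebra.mem_engel_iff ℂ _ _).2 ⟨3, ?_⟩
      by_cases hij : i = j
      · subst hij
        simp [pow_succ, C.lie_e_f, hhe]
      · simp [pow_succ, C.lie_e_f, hij]
  exact (LieSubalgebra.mem_engel_iff ℂ _ _).1 (this ▸ LieSubalgebra.mem_top x)

theorem pow_ad_f_mem_weightSpace (C : ChevalleyGenerators A h e f) (i : ι) {χ : ι → ℂ} {x : L}
    (hx : x ∈ weightSpace h χ) (n : ℕ) :
    ((LieAlgebra.ad ℂ L (f i)) ^ n) x ∈ weightSpace h (fun k => χ k - n * (A k i : ℂ)) := by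
  rw [mem_weightSpace] at hx ⊢
  intro k
  induction n with
  | zero => simpa using hx k
  | succ n ih =>
    rw [pow_succ', Module.End.mul_apply, LieAlgebra.ad_apply, leibniz_lie, ih, C.lie_h_f,
      neg_lie, smul_lie, lie_smul, ← neg_smul, ← add_smul]
    push_cast
    ring_nf

/-- The string of weights `χ, χ - αᵢ, …` reaches the reflection of `χ` if `χ(hᵢ) ≥ 0`. -/
theorem exists_mem_weightSpace_reflection_of_nonneg (hd : ∀ i, A i i = 2)
    (C : ChevalleyGenerators A h e f) (i : ι)
    {χ : ι → ℂ} {x : L} (hx : x ∈ weightSpace h χ) (hx0 : x ≠ 0) {n : ℕ} (hn : χ i = n) :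
    ∃ y ∈ weightSpace h (fun k => χ k - χ i * (A k i : ℂ)), y ≠ 0 := by
  obtain ⟨m, hm⟩ := C.exists_ad_pow_eq_zero i x
  refine ⟨((LieAlgebra.ad ℂ L (f i)) ^ n) x, ?_, fun h0 => hx0 ?_⟩
  · rw [hn]; exact C.pow_ad_f_mem_weightSpace i hx n
  · refine sl2_eq_zero_of_pow_f_eq_zero (e := LieAlgebra.ad ℂ L (e i))
      (f := LieAlgebra.ad ℂ L (f i)) (h := LieAlgebra.ad ℂ L (h i)) (fun y => ?_) (fun y => ?_)
      (fun y => ?_) m n x ?_ hm h0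
    · have := C.lie_e_f i i
      rw [if_pos rfl] at this
      simp only [LieAlgebra.ad_apply]
      rw [leibniz_lie, this, add_comm]
    · simp only [LieAlgebra.ad_apply]
      rw [leibniz_lie, C.lie_h_e, hd, smul_lie, add_comm]
      norm_num
    · simp only [LieAlgebra.ad_apply]
      rw [leibniz_lie, C.lie_h_f, hd, neg_lie, smul_lie, neg_add_eq_sub]
      norm_num
    · simpa [hn] using mem_weightSpace.1 hx i

/-- The set of weights of `L` with integral values on the `hᵢ` is stable under the simple
reflections. -/
theorem exists_mem_weightSpace_reflection (hd : ∀ i, A i i = 2)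
    (C : ChevalleyGenerators A h e f) (i : ι)
    {χ : ι → ℂ} {x : L} (hx : x ∈ weightSpace h χ) (hx0 : x ≠ 0) {n : ℤ} (hn : χ i = n) :
    ∃ y ∈ weightSpace h (fun k => χ k - χ i * (A k i : ℂ)), y ≠ 0 := by
  have hneg : ∀ (χ : ι → ℂ) (x : L), x ∈ weightSpace (-h) χ ↔ x ∈ weightSpace h (-χ) := by
    intro χ x
    simp only [mem_weightSpace, Pi.neg_apply, neg_lie, neg_smul, neg_eq_iff_eq_neg]
  rcases le_total 0 n with h0 | h0
  · lift n to ℕ using h0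
    exact C.exists_mem_weightSpace_reflection_of_nonneg hd i hx hx0 (by simpa using hn)
  -- The string goes up from `χ` if `χ(hᵢ) ≤ 0`; the Chevalley involution exchanges the two cases.
  · obtain ⟨m, rfl⟩ : ∃ m : ℕ, n = -m := ⟨n.natAbs, by omega⟩
    obtain ⟨y, hy, hy0⟩ := C.symm.exists_mem_weightSpace_reflection_of_nonneg hd i (χ := -χ)
      ((hneg _ _).2 (by simpa using hx)) hx0 (n := m) (by simp [hn])
    refine ⟨y, ?_, hy0⟩
    rw [hneg] at hy
    convert hy using 2
    funext k
    simp only [Pi.neg_apply]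
    ring

end ChevalleyGenerators

theorem wordContent_nonneg (j : ι) (l : List ι) : 0 ≤ wordContent j l := by
  induction l with
  | nil => exact Pi.single_nonneg.2 zero_le_one
  | cons i l ih => exact add_nonneg (Pi.single_nonneg.2 zero_le_one) ih

theorem wordContent_pos (j : ι) (l : List ι) : 0 < wordContent j l j := by
  induction l with
  | nil => simp [wordContent]
  | cons i l ih =>
    have : (0 : ι → ℤ) ≤ Pi.single i 1 := Pi.single_nonneg.2 zero_le_one
    exact add_pos_of_nonneg_of_pos (this j) ih

theorem wordContent_pos_of_mem (j : ι) (l : List ι) {i : ι} (hi : i ∈ l) :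
    0 < wordContent j l i := by
  induction l with
  | nil => simp at hi
  | cons k l ih =>
    change 0 < ((Pi.single k 1 : ι → ℤ) + wordContent j l) i
    rw [Pi.add_apply]
    by_cases hk : i = k
    · subst hk
      rw [Pi.single_eq_same]
      have := wordContent_nonneg j l i
      simp only [Pi.zero_apply] at this
      omega
    · rw [Pi.single_eq_of_ne hk, zero_add]
      exact ih ((List.mem_cons.1 hi).resolve_left hk)

/-- A nonzero bracket involving the single generator `eᵢ` is `eᵢ` itself. -/
theorem wordContent_eq_single (e : ι → L) (i j : ι) (l : List ι) (hw : bracketWord e j l ≠ 0)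
    (hc : ∀ k ≠ i, wordContent j l k = 0) : wordContent j l = Pi.single i 1 := by
  have hj : j = i := by
    by_contra hne
    exact (wordContent_pos j l).ne' (hc j hne)
  subst hj
  have hl : ∀ k ∈ l, k = j := fun k hk => by
    by_contra hne
    exact (wordContent_pos_of_mem j l hk).ne' (hc k hne)
  have hzero : ∀ l : List ι, l ≠ [] → (∀ k ∈ l, k = j) → bracketWord e j l = 0 := by
    intro l
    induction l with
    | nil => intro h; exact absurd rfl h
    | cons k l ih =>
      intro _ hk
      change ⁅e k, bracketWord e j l⁆ = 0
      rw [hk k (by simp)]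
      by_cases hl : l = []
      · subst hl
        exact lie_self (e j)
      · rw [ih hl fun m hm => hk m (by simp [hm]), lie_zero]
  by_cases hnil : l = []
  · subst hnil; rfl
  · exact absurd (hzero l hnil hl) hw

end Chevalley

section KacMoodyAlgebra

variable {ι : Type*} [Fintype ι] [DecidableEq ι]

/-! ### Chevalley generators of the Kac-Moody algebra -/

/-- The projection from the free Lie algebra onto the Kac-Moody algebra. -/
noncomputable def quotientMap (A : Matrix ι ι ℤ) :
    FreeLieAlgebra ℂ (CartanMatrix.Generators ι) →ₗ⁅ℂ⁆ Matrix.ToLieAlgebra ℂ A where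
  toFun := LieSubmodule.Quotient.mk (N := CartanMatrix.Relations.toIdeal ℂ A)
  map_add' _ _ := rfl
  map_smul' _ _ := rfl
  map_lie' := rfl

theorem quotientMap_surjective (A : Matrix ι ι ℤ) : Function.Surjective (quotientMap A) :=
  Quotient.mk_surjective

theorem quotientMap_eq_zero {A : Matrix ι ι ℤ}
    {x : FreeLieAlgebra ℂ (CartanMatrix.Generators ι)}
    (hx : x ∈ CartanMatrix.Relations.toSet ℂ A) : quotientMap A x = 0 :=
  (LieSubmodule.Quotient.mk_eq_zero (N := CartanMatrix.Relations.toIdeal ℂ A)).2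
    (LieSubmodule.subset_lieSpan hx)

theorem quotientMap_ad_pow (A : Matrix ι ι ℤ)
    (x y : FreeLieAlgebra ℂ (CartanMatrix.Generators ι)) (n : ℕ) :
    quotientMap A (((LieAlgebra.ad ℂ _ x) ^ n) y) =
      ((LieAlgebra.ad ℂ _ (quotientMap A x)) ^ n) (quotientMap A y) := by
  induction n with
  | zero => rfl
  | succ n ih =>
    rw [pow_succ', pow_succ', Module.End.mul_apply, Module.End.mul_apply, LieAlgebra.ad_apply,
      LieHom.map_lie, ih, LieAlgebra.ad_apply]

/-- The generator `eᵢ` of the Kac-Moody algebra. -/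
noncomputable def generatorE (A : Matrix ι ι ℤ) (i : ι) : Matrix.ToLieAlgebra ℂ A :=
  quotientMap A (FreeLieAlgebra.of ℂ (CartanMatrix.Generators.E i))

/-- The generator `fᵢ` of the Kac-Moody algebra. -/
noncomputable def generatorF (A : Matrix ι ι ℤ) (i : ι) : Matrix.ToLieAlgebra ℂ A :=
  quotientMap A (FreeLieAlgebra.of ℂ (CartanMatrix.Generators.F i))

theorem generatorH_eq (A : Matrix ι ι ℤ) (i : ι) :
    generatorH A i = quotientMap A (FreeLieAlgebra.of ℂ (CartanMatrix.Generators.H i)) := rfl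

open CartanMatrix.Relations in
theorem chevalleyGenerators (A : Matrix ι ι ℤ) :
    ChevalleyGenerators A (generatorH A) (generatorE A) (generatorF A) where
  lie_h_h i j := by
    rw [generatorH_eq, generatorH_eq, ← LieHom.map_lie]
    exact quotientMap_eq_zero (Or.inl (Or.inl (Or.inl (Or.inl (Or.inl ⟨(i, j), rfl⟩)))))
  lie_e_f i j := by
    have := quotientMap_eq_zero (A := A) (x := EF ℂ (i, j))
      (Or.inl (Or.inl (Or.inl (Or.inl (Or.inr ⟨(i, j), rfl⟩)))))
    rw [generatorE, generatorF, generatorH_eq, ← LieHom.map_lie]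
    by_cases hij : i = j
    · subst hij
      simp only [EF, Function.uncurry_apply_pair, if_true, map_sub, sub_eq_zero] at this
      simpa using this
    · simp only [EF, Function.uncurry_apply_pair, if_neg hij] at this
      simpa [hij] using this
  lie_h_e i j := by
    have := quotientMap_eq_zero (A := A) (x := HE ℂ A (i, j))
      (Or.inl (Or.inl (Or.inl (Or.inr ⟨(i, j), rfl⟩))))
    rw [generatorE, generatorH_eq, ← LieHom.map_lie, Int.cast_smul_eq_zsmul]
    simpa only [HE, Function.uncurry_apply_pair, map_sub, map_zsmul, sub_eq_zero,
      Function.comp_apply] using this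
  lie_h_f i j := by
    have := quotientMap_eq_zero (A := A) (x := HF ℂ A (i, j))
      (Or.inl (Or.inl (Or.inr ⟨(i, j), rfl⟩)))
    rw [generatorF, generatorH_eq, ← LieHom.map_lie, Int.cast_smul_eq_zsmul]
    simpa only [HF, Function.uncurry_apply_pair, map_add, map_zsmul, add_eq_zero_iff_eq_neg,
      Function.comp_apply] using this
  serre_e i j := by
    rw [generatorE, generatorE, ← LieHom.map_lie, ← quotientMap_ad_pow]
    exact quotientMap_eq_zero (Or.inl (Or.inr ⟨(i, j), rfl⟩))
  serre_f i j := by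
    rw [generatorF, generatorF, ← LieHom.map_lie, ← quotientMap_ad_pow]
    exact quotientMap_eq_zero (Or.inr ⟨(i, j), rfl⟩)
  generate S hh he hf := by
    have hmem : ∀ g, quotientMap A (FreeLieAlgebra.of ℂ g) ∈ S := by
      rintro (i | i | i)
      · exact hh i
      · exact he i
      · exact hf i
    let φ : FreeLieAlgebra ℂ (CartanMatrix.Generators ι) →ₗ⁅ℂ⁆ S :=
      FreeLieAlgebra.lift ℂ fun g => ⟨_, hmem g⟩
    have hφ : S.incl.comp φ = quotientMap A := by
      refine FreeLieAlgebra.hom_ext fun g => ?_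
      simp [φ]
    refine eq_top_iff.2 fun x _ => ?_
    obtain ⟨y, rfl⟩ := quotientMap_surjective A x
    rw [← hφ]
    exact (φ y).2

/-! ### The root lattice -/

/-- The element `∑ i, cᵢ αᵢ` of the root lattice. -/
noncomputable def latticeVector (A : Matrix ι ι ℤ) (c : ι → ℤ) : Module.Dual ℂ (Cartan ι) :=
  ∑ i, c i • simpleRoot A i

theorem latticeVector_coroot (A : Matrix ι ι ℤ) (c : ι → ℤ) (i : ι) :
    latticeVector A c (simpleCoroot i) = latticeWeight A c i := by
  simp [latticeVector, latticeWeight, LinearMap.sum_apply, simpleRoot_simpleCoroot,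
    Matrix.mulVec, dotProduct, mul_comm]

theorem dual_ext {γ δ : Module.Dual ℂ (Cartan ι)}
    (hγ : ∀ i, γ (simpleCoroot i) = δ (simpleCoroot i)) : γ = δ :=
  (Pi.basisFun ℂ ι).ext fun i => by simpa [simpleCoroot] using hγ i

theorem latticeVector_add (A : Matrix ι ι ℤ) (c d : ι → ℤ) :
    latticeVector A (c + d) = latticeVector A c + latticeVector A d := by
  simp [latticeVector, add_smul, Finset.sum_add_distrib]

theorem latticeVector_neg (A : Matrix ι ι ℤ) (c : ι → ℤ) :
    latticeVector A (-c) = -latticeVector A c := by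
  simp [latticeVector]

theorem latticeVector_sub (A : Matrix ι ι ℤ) (c d : ι → ℤ) :
    latticeVector A (c - d) = latticeVector A c - latticeVector A d := by
  rw [sub_eq_add_neg, latticeVector_add, latticeVector_neg, sub_eq_add_neg]

theorem latticeVector_single (A : Matrix ι ι ℤ) (i : ι) (n : ℤ) :
    latticeVector A (Pi.single i n) = n • simpleRoot A i := by
  rw [latticeVector, Finset.sum_eq_single i]
  · simp
  · intro j _ hj; simp [hj]
  · simp

theorem latticeVector_injective {A : Matrix ι ι ℤ} (hdet : A.det ≠ 0) :
    Function.Injective (latticeVector A) := by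
  intro c d hcd
  rw [← sub_eq_zero]
  refine Matrix.eq_zero_of_mulVec_eq_zero hdet ?_
  funext i
  have := congrArg (fun γ => γ (simpleCoroot i)) hcd
  simp only [latticeVector_coroot, latticeWeight, Int.cast_inj] at this
  simp [Matrix.mulVec_sub, this]

/-- The simple reflection in coordinates with respect to the simple roots. -/
def latticeReflection (A : Matrix ι ι ℤ) (i : ι) (c : ι → ℤ) : ι → ℤ :=
  c - Pi.single i (A.mulVec c i)

theorem simpleReflection_apply {A : Matrix ι ι ℤ} (hA : IsGCM A) (i : ι)
    (γ : Module.Dual ℂ (Cartan ι)) :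
    simpleReflection hA i γ = γ - γ (simpleCoroot i) • simpleRoot A i :=
  Module.reflection_apply _ _

theorem simpleReflection_latticeVector {A : Matrix ι ι ℤ} (hA : IsGCM A) (i : ι) (c : ι → ℤ) :
    simpleReflection hA i (latticeVector A c) = latticeVector A (latticeReflection A i c) := by
  rw [simpleReflection_apply, latticeVector_coroot, latticeReflection, latticeVector_sub,
    latticeVector_single, latticeWeight, Int.cast_smul_eq_zsmul]

theorem simpleReflection_mul_self {A : Matrix ι ι ℤ} (hA : IsGCM A) (i : ι) :
    simpleReflection hA i * simpleReflection hA i = 1 :=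
  LinearEquiv.ext fun γ => Module.involutive_reflection _ γ

theorem mulVec_latticeReflection (A : Matrix ι ι ℤ) (i k : ι) (c : ι → ℤ) :
    A.mulVec (latticeReflection A i c) k = A.mulVec c k - A k i * A.mulVec c i := by
  rw [latticeReflection, Matrix.mulVec_sub, Pi.sub_apply, Matrix.mulVec_single]
  simp

theorem latticeReflection_latticeReflection {A : Matrix ι ι ℤ} (hd : ∀ i, A i i = 2) (i : ι)
    (c : ι → ℤ) : latticeReflection A i (latticeReflection A i c) = c := by
  rw [latticeReflection, mulVec_latticeReflection, hd, latticeReflection, sub_sub,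
    ← Pi.single_add]
  ring_nf
  simp

/-! ### Roots of the Kac-Moody algebra -/

theorem mem_roots_iff {A : Matrix ι ι ℤ} {γ : Module.Dual ℂ (Cartan ι)} :
    γ ∈ roots A ↔ γ ≠ 0 ∧
      ∃ x ∈ weightSpace (generatorH A) (fun i => γ (simpleCoroot i)), x ≠ 0 := by
  have key : ∀ x : Matrix.ToLieAlgebra ℂ A, (∀ h : Cartan ι, ⁅cartanInclusion A h, x⁆ = γ h • x) ↔
      x ∈ weightSpace (generatorH A) (fun i => γ (simpleCoroot i)) := by
    intro x
    rw [mem_weightSpace]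
    constructor
    · intro hx i
      simpa [cartanInclusion, simpleCoroot] using hx (simpleCoroot i)
    · intro hx h
      have hγ : γ h = ∑ i, h i * γ (simpleCoroot i) := by
        conv_lhs => rw [← (Pi.basisFun ℂ ι).sum_repr h]
        simp [simpleCoroot]
      rw [hγ, Finset.sum_smul, cartanInclusion, Fintype.linearCombination_apply,
        sum_lie]
      exact Finset.sum_congr rfl fun i _ => by rw [smul_lie, hx i, mul_smul]
  constructor
  · rintro ⟨h0, x, hx0, hx⟩
    exact ⟨h0, x, (key x).1 hx, hx0⟩
  · rintro ⟨h0, x, hx, hx0⟩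
    exact ⟨h0, x, hx0, (key x).2 hx⟩

/-- A root is, up to sign, a sum of simple roots. If it is a multiple of a simple root `αᵢ`, then it
is `αᵢ` or `-αᵢ`. -/
theorem exists_latticeVector_of_mem_roots {A : Matrix ι ι ℤ} {γ : Module.Dual ℂ (Cartan ι)}
    (hγ : γ ∈ roots A) :
    ∃ c : ι → ℤ, 0 ≤ c ∧ c ≠ 0 ∧ (γ = latticeVector A c ∨ γ = -latticeVector A c) ∧
      ∀ i, (∀ k ≠ i, c k = 0) → c = Pi.single i 1 := by
  obtain ⟨h0, x, hx, hx0⟩ := mem_roots_iff.1 hγ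
  have hχ : (fun i => γ (simpleCoroot i)) ≠ 0 := fun hc =>
    h0 (dual_ext fun i => by simpa using congrFun hc i)
  obtain ⟨j, l, h⟩ := (chevalleyGenerators A).exists_word_of_mem_weightSpace hx hx0 hχ
  refine ⟨wordContent j l, wordContent_nonneg j l, fun hc => ?_, ?_, fun i hi => ?_⟩
  · exact (wordContent_pos j l).ne' (congrFun hc j)
  · refine h.imp (fun h => dual_ext fun i => ?_) (fun h => dual_ext fun i => ?_)
    · rw [latticeVector_coroot, ← h.1]
    · rw [LinearMap.neg_apply, latticeVector_coroot]
      exact congrFun h.1 i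
  · rcases h with h | h
    · exact wordContent_eq_single _ i j l h.2 hi
    · exact wordContent_eq_single _ i j l h.2 hi

/-- A root with coordinates `c` is positive or negative. -/
theorem nonneg_or_nonpos_of_mem_roots {A : Matrix ι ι ℤ} (hdet : A.det ≠ 0) {c : ι → ℤ}
    (hc : latticeVector A c ∈ roots A) : 0 ≤ c ∨ c ≤ 0 := by
  obtain ⟨d, hd, -, h | h, -⟩ := exists_latticeVector_of_mem_roots hc
  · rw [latticeVector_injective hdet h]
    exact Or.inl hd
  · rw [← latticeVector_neg] at h
    rw [latticeVector_injective hdet h]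
    exact Or.inr (neg_nonpos.2 hd)

theorem ne_zero_of_mem_roots {A : Matrix ι ι ℤ} {c : ι → ℤ}
    (hc : latticeVector A c ∈ roots A) : c ≠ 0 := by
  rintro rfl
  exact hc.1 (by simp [latticeVector])

theorem eq_single_of_mem_roots {A : Matrix ι ι ℤ} (hdet : A.det ≠ 0) {c : ι → ℤ}
    (hc : latticeVector A c ∈ roots A) (hc0 : 0 ≤ c) {i : ι} (hi : ∀ k ≠ i, c k = 0) :
    c = Pi.single i 1 := by
  obtain ⟨d, hd, hd0, h | h, hs⟩ := exists_latticeVector_of_mem_roots hc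
  · have hcd := latticeVector_injective hdet h
    subst hcd
    exact hs i hi
  · rw [← latticeVector_neg] at h
    have hcd := latticeVector_injective hdet h
    exact absurd (le_antisymm (neg_nonneg.1 (hcd ▸ hc0)) hd) hd0

theorem latticeReflection_mem_roots {A : Matrix ι ι ℤ} (hA : IsGCM A) {c : ι → ℤ} (i : ι)
    (hc : latticeVector A c ∈ roots A) :
    latticeVector A (latticeReflection A i c) ∈ roots A := by
  obtain ⟨h0, x, hx, hx0⟩ := mem_roots_iff.1 hc
  rw [← simpleReflection_latticeVector hA]
  refine mem_roots_iff.2 ⟨fun h => h0 ((LinearEquiv.map_eq_zero_iff _).1 h), ?_⟩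
  obtain ⟨y, hy, hy0⟩ := (chevalleyGenerators A).exists_mem_weightSpace_reflection hA.diag i hx hx0
    (n := A.mulVec c i) (latticeVector_coroot A c i)
  refine ⟨y, ?_, hy0⟩
  convert hy using 2
  funext k
  rw [simpleReflection_apply, LinearMap.sub_apply, LinearMap.smul_apply, simpleRoot_simpleCoroot,
    smul_eq_mul]

/-- The simple reflection in `αᵢ` permutes the positive roots other than `αᵢ`. -/
theorem latticeReflection_nonneg {A : Matrix ι ι ℤ} (hA : IsGCM A) (hdet : A.det ≠ 0)
    {c : ι → ℤ} (hc : latticeVector A c ∈ roots A) (hc0 : 0 ≤ c) {i : ι}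
    (hi : c ≠ Pi.single i 1) : 0 ≤ latticeReflection A i c := by
  refine (nonneg_or_nonpos_of_mem_roots hdet (latticeReflection_mem_roots hA i hc)).resolve_right
    fun hneg => hi (eq_single_of_mem_roots hdet hc hc0 fun k hk => ?_)
  refine le_antisymm ?_ (hc0 k)
  simpa [latticeReflection, hk] using hneg k

/-! ### The invariant form -/

/-- The norm `(γ, γ) = ∑ i j, cᵢ aᵢⱼ cⱼ` of the root lattice vector with coordinates `c`. -/
def latticeNorm (A : Matrix ι ι ℤ) (c : ι → ℤ) : ℤ := c ⬝ᵥ A.mulVec c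

theorem latticeNorm_sub_single {A : Matrix ι ι ℤ} (hd : ∀ i, A i i = 2) (hsymm : A.IsSymm)
    (c : ι → ℤ) (i : ι) (n : ℤ) :
    latticeNorm A (c - Pi.single i n) = latticeNorm A c - 2 * n * A.mulVec c i + 2 * n ^ 2 := by
  have hs : c ⬝ᵥ A.mulVec (Pi.single i n) = n * A.mulVec c i := by
    rw [Matrix.dotProduct_mulVec, ← Matrix.mulVec_transpose, hsymm.eq, dotProduct_single, mul_comm]
  have hs' : (Pi.single i n : ι → ℤ) ⬝ᵥ A.mulVec (Pi.single i n) = 2 * n ^ 2 := by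
    rw [single_dotProduct, Matrix.mulVec_single]
    simp [hd]
    ring
  rw [latticeNorm, Matrix.mulVec_sub, sub_dotProduct, dotProduct_sub, dotProduct_sub, hs, hs',
    single_dotProduct, latticeNorm]
  ring

theorem latticeNorm_latticeReflection {A : Matrix ι ι ℤ} (hd : ∀ i, A i i = 2)
    (hsymm : A.IsSymm) (i : ι) (c : ι → ℤ) :
    latticeNorm A (latticeReflection A i c) = latticeNorm A c := by
  rw [latticeReflection, latticeNorm_sub_single hd hsymm]
  ring

theorem latticeNorm_single {A : Matrix ι ι ℤ} (hd : ∀ i, A i i = 2) (i : ι) :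
    latticeNorm A (Pi.single i 1) = 2 := by
  simp [latticeNorm, hd]

/-- Positive roots have norm at most `2`: reflections that decrease the height lead to a simple
root, of norm `2`, or to an antidominant vector, of norm at most `0`. -/
theorem latticeNorm_le_two {A : Matrix ι ι ℤ} (hA : IsGCM A) (hdet : A.det ≠ 0)
    (hsymm : A.IsSymm) (n : ℕ) : ∀ c : ι → ℤ, latticeVector A c ∈ roots A → 0 ≤ c →
      ∑ i, c i ≤ n → latticeNorm A c ≤ 2 := by
  induction n with
  | zero =>
    intro c hc hc0 hn
    refine absurd ?_ (ne_zero_of_mem_roots hc)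
    have h0 := le_antisymm hn (Finset.sum_nonneg fun i _ => hc0 i)
    funext i
    exact (Finset.sum_eq_zero_iff_of_nonneg fun i _ => hc0 i).1 h0 i (Finset.mem_univ i)
  | succ n ih =>
    intro c hc hc0 hn
    by_cases hneg : ∀ i, A.mulVec c i ≤ 0
    · refine le_trans (Finset.sum_nonpos fun i _ => ?_) (by norm_num)
      exact mul_nonpos_of_nonneg_of_nonpos (hc0 i) (hneg i)
    · push Not at hneg
      obtain ⟨i, hi⟩ := hneg
      by_cases hs : c = Pi.single i 1
      · rw [hs, latticeNorm_single hA.diag]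
      · rw [← latticeNorm_latticeReflection hA.diag hsymm i]
        refine ih _ (latticeReflection_mem_roots hA i hc)
          (latticeReflection_nonneg hA hdet hc hc0 hs) ?_
        have : ∑ k, latticeReflection A i c k = ∑ k, c k - A.mulVec c i := by
          simp [latticeReflection, Finset.sum_sub_distrib]
        push_cast at hn
        omega

/-! ### Inversions of words without repetitions -/

/-- The vector `γ` has norm `2`, and `(γ, αᵢ) ≤ -(γ, αⱼ) ≤ -2` for all `i ≠ j`. For a suitable
matrix this holds for the positive roots `γ` such that `wⱼ` decreases the height of `γ`. -/
structure HasDescent (A : Matrix ι ι ℤ) (j : ι) (c : ι → ℤ) : Prop where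
  norm : latticeNorm A c = 2
  two_le : 2 ≤ A.mulVec c j
  le_neg : ∀ i ≠ j, A.mulVec c i ≤ -A.mulVec c j

theorem hasDescent_single {A : Matrix ι ι ℤ} (hd : ∀ i, A i i = 2)
    (hA2 : ∀ i j, i ≠ j → A i j ≤ -2) (j : ι) : HasDescent A j (Pi.single j 1) where
  norm := latticeNorm_single hd j
  two_le := by simp [hd]
  le_neg i hi := by simpa [hd] using hA2 i j hi

theorem HasDescent.latticeReflection {A : Matrix ι ι ℤ} (hd : ∀ i, A i i = 2)
    (hsymm : A.IsSymm) (hA2 : ∀ i j, i ≠ j → A i j ≤ -2) {j k : ι} (hjk : j ≠ k) {c : ι → ℤ}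
    (hc : HasDescent A k c) : HasDescent A j (latticeReflection A j c) where
  norm := by rw [latticeNorm_latticeReflection hd hsymm, hc.norm]
  two_le := by
    rw [mulVec_latticeReflection, hd]
    have := hc.le_neg j hjk
    have := hc.two_le
    omega
  le_neg i hi := by
    rw [mulVec_latticeReflection, mulVec_latticeReflection, hd]
    have h1 := hc.le_neg j hjk
    have h2 := hc.two_le
    have h3 := hA2 i j hi
    have h4 : A.mulVec c i ≤ -A.mulVec c j := by
      by_cases hik : i = k
      · subst hik; omega
      · have := hc.le_neg i hik; omega
    nlinarith

theorem reverse_prod_cons {A : Matrix ι ι ℤ} (hA : IsGCM A) (j : ι) (r : List ι) :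
    (((j :: r).reverse.map (simpleReflection hA)).prod) =
      ((r.reverse.map (simpleReflection hA)).prod) * simpleReflection hA j := by
  simp

/-- A nonnegative root that is made negative by a word (read from the right) without equal
consecutive letters is as in `HasDescent` for the first letter read. -/
theorem exists_hasDescent_of_inversion {A : Matrix ι ι ℤ} (hA : IsGCM A) (hdet : A.det ≠ 0)
    (hsymm : A.IsSymm) (hA2 : ∀ i j, i ≠ j → A i j ≤ -2) (r : List ι)
    (hr : r.IsChain (· ≠ ·)) : ∀ c : ι → ℤ, latticeVector A c ∈ roots A → 0 ≤ c →
      (∃ d : ι → ℤ, d ≤ 0 ∧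
        (r.reverse.map (simpleReflection hA)).prod (latticeVector A c) = latticeVector A d) →
      ∃ j, r.head? = some j ∧ HasDescent A j c := by
  induction r with
  | nil =>
    rintro c hc hc0 ⟨d, hd, h⟩
    simp only [List.reverse_nil, List.map_nil, List.prod_nil, LinearEquiv.coe_one, id_eq] at h
    rw [latticeVector_injective hdet h] at hc0 hc
    exact absurd (le_antisymm hd hc0) (ne_zero_of_mem_roots hc)
  | cons j r ih =>
    rintro c hc hc0 ⟨d, hd, h⟩
    refine ⟨j, rfl, ?_⟩
    by_cases hs : c = Pi.single j 1
    · rw [hs]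
      exact hasDescent_single hA.diag hA2 j
    · rw [reverse_prod_cons, LinearEquiv.mul_apply, simpleReflection_latticeVector] at h
      obtain ⟨k, hk, hdk⟩ := ih hr.tail _ (latticeReflection_mem_roots hA j hc)
        (latticeReflection_nonneg hA hdet hc hc0 hs) ⟨d, hd, h⟩
      obtain ⟨r', rfl⟩ : ∃ r', r = k :: r' := by
        cases r with
        | nil => simp at hk
        | cons a r' => exact ⟨r', by simpa using hk⟩
      have hjk : j ≠ k := (List.isChain_cons_cons.1 hr).1
      rw [← latticeReflection_latticeReflection hA.diag j c]
      exact hdk.latticeReflection hA.diag hsymm hA2 hjk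

theorem sub_single_not_mem_roots {A : Matrix ι ι ℤ} (hA : IsGCM A) (hdet : A.det ≠ 0)
    (hsymm : A.IsSymm) {i j : ι} (hij : i ≠ j) {c : ι → ℤ} (hc0 : 0 ≤ c)
    (hc : HasDescent A j c) : latticeVector A (c - Pi.single i 1) ∉ roots A := by
  intro hroot
  have h1 := hc.le_neg i hij
  have h2 := hc.two_le
  rcases nonneg_or_nonpos_of_mem_roots hdet hroot with h0 | h0
  · have := latticeNorm_le_two hA hdet hsymm _ _ hroot h0 (Int.self_le_toNat _)
    rw [latticeNorm_sub_single hA.diag hsymm, hc.norm] at this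
    omega
  -- If `γ - αᵢ ≤ 0`, then `γ` is a nonnegative multiple of `αᵢ`, whereas `(γ, αᵢ) < 0`.
  · have hci : c = Pi.single i (c i) := by
      funext k
      by_cases hk : k = i
      · subst hk; simp
      · rw [Pi.single_eq_of_ne hk]
        refine le_antisymm ?_ (hc0 k)
        simpa [hk] using h0 k
    have h3 : A.mulVec c i = 2 * c i := by
      conv_lhs => rw [hci, Matrix.mulVec_single]
      simp [hA.diag, mul_comm]
    have h4 : 0 ≤ c i := hc0 i
    omega

/-! ### Reduced words -/

theorem exists_word_of_mem_weylGroup {A : Matrix ι ι ℤ} (hA : IsGCM A)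
    {w : Module.Dual ℂ (Cartan ι) ≃ₗ[ℂ] Module.Dual ℂ (Cartan ι)} (hw : w ∈ weylGroup hA) :
    ∃ l : List ι, (l.map (simpleReflection hA)).prod = w := by
  induction hw using Subgroup.closure_induction with
  | mem x hx =>
    obtain ⟨i, rfl⟩ := hx
    exact ⟨[i], by simp⟩
  | one => exact ⟨[], rfl⟩
  | mul x y _ _ hx hy =>
    obtain ⟨l, rfl⟩ := hx
    obtain ⟨m, rfl⟩ := hy
    exact ⟨l ++ m, by simp⟩
  | inv x _ hx =>
    obtain ⟨l, rfl⟩ := hx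
    refine ⟨l.reverse, ?_⟩
    rw [List.prod_inv_reverse, List.map_map, List.map_reverse]
    congr 2

theorem prod_mem_weylGroup {A : Matrix ι ι ℤ} (hA : IsGCM A) (l : List ι) :
    (l.map (simpleReflection hA)).prod ∈ weylGroup hA := by
  refine Subgroup.list_prod_mem _ fun x hx => ?_
  obtain ⟨i, -, rfl⟩ := List.mem_map.1 hx
  exact Subgroup.subset_closure ⟨i, rfl⟩

theorem weylLength_prod_le {A : Matrix ι ι ℤ} (hA : IsGCM A) (l : List ι) :
    weylLength hA (l.map (simpleReflection hA)).prod ≤ l.length :=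
  Nat.sInf_le ⟨l, rfl, rfl⟩

/-- Every element of the Weyl group has a word of minimal length; it has no equal consecutive
letters. -/
theorem exists_reduced_word {A : Matrix ι ι ℤ} (hA : IsGCM A)
    {w : Module.Dual ℂ (Cartan ι) ≃ₗ[ℂ] Module.Dual ℂ (Cartan ι)} (hw : w ∈ weylGroup hA) :
    ∃ l : List ι, l.length = weylLength hA w ∧ (l.map (simpleReflection hA)).prod = w ∧
      l.IsChain (· ≠ ·) := by
  obtain ⟨l₀, hl₀⟩ := exists_word_of_mem_weylGroup hA hw
  have hne : {n | ∃ l : List ι, l.length = n ∧ (l.map (simpleReflection hA)).prod = w}.Nonempty :=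
    ⟨l₀.length, l₀, rfl, hl₀⟩
  obtain ⟨l, hlen, hl⟩ := Nat.sInf_mem hne
  refine ⟨l, hlen, hl, List.isChain_iff_forall_rel_of_append_cons_cons.2 ?_⟩
  rintro i j l₁ l₂ rfl rfl
  have hlen' : (l₁ ++ i :: i :: l₂).length = weylLength hA w := hlen
  have hw' : ((l₁ ++ l₂).map (simpleReflection hA)).prod = w := by
    rw [← hl]
    simp only [List.map_append, List.map_cons, List.prod_append, List.prod_cons]
    rw [← mul_assoc (simpleReflection hA i), simpleReflection_mul_self, one_mul]
  have := weylLength_prod_le hA (l₁ ++ l₂)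
  rw [hw', ← hlen'] at this
  simp only [List.length_append, List.length_cons] at this
  omega

theorem descentProperty_roots {A : Matrix ι ι ℤ} (hA : IsGCM A) (hdet : A.det ≠ 0)
    (hsymm : A.IsSymm) (hA2 : ∀ i j, i ≠ j → A i j ≤ -2) : DescentProperty hA (roots A) := by
  intro w hw hw1
  obtain ⟨l, hlen, hl, hchain⟩ := exists_reduced_word hA hw
  obtain ⟨i, r, hr⟩ : ∃ i r, l.reverse = i :: r := by
    cases h : l.reverse with
    | nil =>
      rw [List.reverse_eq_nil_iff] at h
      subst h
      exact absurd hl.symm hw1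
    | cons i r => exact ⟨i, r, rfl⟩
  obtain rfl : l = (i :: r).reverse := by rw [← hr, List.reverse_reverse]
  have hchain' : (i :: r).IsChain (· ≠ ·) := by
    rw [List.isChain_reverse] at hchain
    exact hchain.imp fun _ _ h => h.symm
  refine ⟨_, prod_mem_weylGroup hA r.reverse, i, ?_, ?_, ?_⟩
  · rw [← hl, reverse_prod_cons]
  · refine (weylLength_prod_le hA r.reverse).trans_lt ?_
    rw [← hlen]
    simp
  · rintro α ⟨⟨hα, m, rfl⟩, -, m', hm'⟩
    have hcast : ∀ m : ι → ℕ, ∑ k, m k • simpleRoot A k = latticeVector A (fun k => (m k : ℤ)) :=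
      fun m => by simp [latticeVector]
    rw [hcast] at hα hm' ⊢
    rw [hcast, ← latticeVector_neg] at hm'
    have hnn : ∀ m : ι → ℕ, (0 : ι → ℤ) ≤ fun k => (m k : ℤ) := fun m k => Int.natCast_nonneg _
    obtain ⟨j, hj, hdesc⟩ := exists_hasDescent_of_inversion hA hdet hsymm hA2 r hchain'.tail _ hα
      (hnn m) ⟨_, neg_nonpos.2 (hnn m'), hm'⟩
    have hij : i ≠ j := by
      cases r with
      | nil => simp at hj
      | cons a r' =>
        obtain rfl : a = j := by simpa using hj
        exact (List.isChain_cons_cons.1 hchain').1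
    have := sub_single_not_mem_roots hA hdet hsymm hij (hnn m) hdesc
    rwa [latticeVector_sub, latticeVector_single, one_smul] at this

end KacMoodyAlgebra

end KacMoody

theorem proposition4p3 {ι : Type*} [Fintype ι] [DecidableEq ι] (A : Matrix ι ι ℤ)
    (hA : KacMoody.IsGCM A) (hdet : A.det ≠ 0) (hsymm : A.IsSymm) (hA2 : ∀ i j, 2 ≤ |A i j|) :
    KacMoody.DescentProperty hA (KacMoody.realRoots hA) ∧
      KacMoody.DescentProperty hA (KacMoody.roots A) := by
  have hA2' : ∀ i j, i ≠ j → A i j ≤ -2 := fun i j hij => by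
    have h1 := hA2 i j
    rw [abs_of_nonpos (hA.nonpos i j hij)] at h1
    omega
  have h := KacMoody.descentProperty_roots hA hdet hsymm hA2'
  refine ⟨fun w hw hw1 => ?_, h⟩
  obtain ⟨v, hv, i, h1, h2, h3⟩ := h w hw hw1
  exact ⟨v, hv, i, h1, h2, fun α hα hreal => h3 α hα hreal.1⟩
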